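/- Let $\gamma:[0,\infty)\to[0,\infty)$ be increasing (not necessarily strictly) and càdlàg with $\gamma(0)=0$, and write $\gamma(ds)$ for the induced measure. Let $b_1,c$ be bounded Borel functions on $[0,\infty)$ and let $m(s,dz)$ be a kernel from $[0,\infty)$ to $(0,\infty)$ such that $(1\wedge z^2)\,m(s,dz)$ is a bounded kernel. Put $$K_1(\lambda,z)=e^{-\lambda z}-1+\lambda z\mathbf 1_{\{z\le 1\}},\qquad \phi(s,\lambda)=b_1(s)\lambda+c(s)\lambda^2+\int_{(0,\infty)}K_1(\lambda,z)\,m(s,dz).$$ Assume that $c\ge 0$ and, for every $s>0$: (1') $c(s)\gamma(\{s\})=0$; (2') $\big[b_1(s)+\int_{(0,1]}z\,m(s,dz)\big]\gamma(\{s\})\le 1$ (with $\infty\cdot 0=0$); (3') $m(s,(1,\infty))\,\gamma(\{s\})>0$ whenever $b_1(s)\gamma(\{s\})=1$. For each $k\ge1$ let $\{g_{k,n}\}_{n\ge0}$ be probability generating functions of distributions on $\{0,1,2,\dots\}$; put $g_{k,i,n}=g_{k,i}\circ g_{k,i+1}\circ\cdots\circ g_{k,n-1}$ for $n>i$ and $g_{k,i,i}(z)=z$.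 Let $(\beta_k)_{k\ge1}$ be an increasing real sequence tending to $\infty$, and let $\gamma_k(t)=\lfloor\beta_k\gamma(t)\rfloor$ (read as $0$ if $\beta_k<0$), $\gamma_k^{-1}(i)=\inf\{s\ge0:\gamma_k(s)\ge i\}$, $\Delta\gamma_k(s)=\gamma_k(s)-\gamma_k(s-)$. The discrete cumulant semigroup is $$v_k(r,t;\lambda)=-k\log g_{k,\gamma_k(r),\gamma_k(t)}\big(e^{-\lambda/k}\big),\qquad 0\le r\le t,\ \lambda>0 .$$ For $0\le r\le t$ let $J_k(r,t)=\{s\in(r,t]:\Delta\gamma_k(s)\ge1\}$, and for $s\in J_k(r,t)$ let $I_{k,s}(\lambda)=|I_{k,s,1}(\lambda)|+|I_{k,s,2}(\lambda)|$, where $$I_{k,s,1}(\lambda)=k\big[g_{k,\gamma_k(s-)}(1-\lambda/k)-(1-\lambda/k)\big]-\int_{(\gamma_k^{-1}(\gamma_k(s-)),\,s)}\phi(u,\lambda)\,\gamma(du),$$ $$I_{k,s,2}(\lambda)=k\big[g_{k,\gamma_k(s-)+1,\gamma_k(s)}(1-\lambda/k)-(1-\lambda/k)\big]-\phi(s,\lambda)\,\gamma(\{s\}).$$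 Condition (A): for every $M>0$ there are non-negative càdlàg increasing functions $F_k$ on $[0,\infty)$, $k\ge1$, with $\lim_{k\to\infty}F_k(s)=0$ for each $s\ge0$, such that for each $T\ge0$ and every sequence of functions $\lambda_k:[0,T]\to[0,M]$, $$\sum_{s\in J_k(r,t)}I_{k,s}(\lambda_k(s))\le F_k(t)-F_k(r),\qquad 0\le r\le t\le T,\ k\ge1,\ k\ge M.$$ Theorem. Suppose that condition (A) holds. Then for every $T\ge0$ and $0<a<b$ there exist an integer $N_1\ge1$ and constants $U\ge l>0$ such that $$l\le v_k(r,t;\lambda)\le U\qquad\text{for all }0\le r\le t\le T,\ \lambda\in[a,b],\ k\ge N_1 .$$ -/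

import Mathlib

open Set Filter Topology MeasureTheory ProbabilityTheory

noncomputable section

namespace GWVE

/-- The kernel `K₁(λ, z) = e^{-λ z} - 1 + λ z 1_{z ≤ 1}`. -/
def K₁ (lam z : ℝ) : ℝ :=
  Real.exp (-lam * z) - 1 + if z ≤ 1 then lam * z else 0

/-- The branching mechanism
`φ(s, λ) = b₁(s) λ + c(s) λ² + ∫_{(0,∞)} K₁(λ, z) m(s, dz)`. -/
def phi (b₁ c : ℝ → ℝ) (m : Kernel ℝ ℝ) (s lam : ℝ) : ℝ :=
  b₁ s * lam + c s * lam ^ 2 + ∫ z in Ioi (0 : ℝ), K₁ lam z ∂(m s)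

/-- Standing assumptions on `γ` and `(b₁, c, m)`.  An increasing right-continuous function on
`[0,∞)` is represented by a Stieltjes function on `ℝ`, of which only the values on `[0,∞)` are
used; likewise only times `s ≥ 0` of `b₁, c, m`, and only the restriction of `m(s, ·)` to
`(0,∞)`, are used. -/
structure Admissible (γ : StieltjesFunction ℝ) (b₁ c : ℝ → ℝ) (m : Kernel ℝ ℝ) : Prop where
  γ_zero : γ 0 = 0
  measurable_b₁ : Measurable b₁
  measurable_c : Measurable c
  bounded_b₁ : ∃ C : ℝ, ∀ s, 0 ≤ s → |b₁ s| ≤ C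
  bounded_c : ∃ C : ℝ, ∀ s, 0 ≤ s → |c s| ≤ C
  /-- `(1 ∧ z²) m(s, dz)` is a bounded kernel on `(0,∞)`. -/
  bounded_m : ∃ C : ℝ, ∀ s, 0 ≤ s →
    ∫⁻ z in Ioi (0 : ℝ), ENNReal.ofReal (min 1 (z ^ 2)) ∂(m s) ≤ ENNReal.ofReal C
  c_nonneg : ∀ s, 0 ≤ s → 0 ≤ c s
  c_atom : ∀ s, 0 < s → c s * γ.measure.real {s} = 0
  /-- `[b₁(s) + ∫_{(0,1]} z m(s, dz)] γ({s}) ≤ 1`, with `∞ · 0 = 0`: the integral is finite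
  as soon as `s` is an atom of `γ`, and there is nothing to check at other points. -/
  jump_le_one : ∀ s, 0 < s → 0 < γ.measure.real {s} →
    IntegrableOn (fun z : ℝ => z) (Ioc 0 1) (m s) ∧
      (b₁ s + ∫ z in Ioc (0 : ℝ) 1, z ∂(m s)) * γ.measure.real {s} ≤ 1
  big_jumps : ∀ s, 0 < s → b₁ s * γ.measure.real {s} = 1 →
    0 < m s (Ioi 1) * γ.measure {s}

/-- The probability generating function `z ↦ ∑ⱼ pⱼ zʲ` of a distribution on `{0, 1, 2, …}`. -/
def pgf (p : PMF ℕ) (z : ℝ) : ℝ := ∑' j : ℕ, (p j).toReal * z ^ j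

/-- `compFrom g i d = g i ∘ g (i+1) ∘ ⋯ ∘ g (i+d-1)` (`d` factors). -/
def compFrom (g : ℕ → ℝ → ℝ) : ℕ → ℕ → ℝ → ℝ
  | _, 0, z => z
  | i, d + 1, z => g i (compFrom g (i + 1) d z)

/-- `g_{i,n}(z) = g_i(g_{i+1}(⋯ g_{n-1}(z) ⋯))` for `n ≥ i + 1`, and `g_{i,i}(z) = z`, where
`g_n` is the generating function of the offspring distribution `p n`. -/
def multiPgf (p : ℕ → PMF ℕ) (i n : ℕ) (z : ℝ) : ℝ :=
  compFrom (fun j => pgf (p j)) i (n - i) z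

/-- The discrete time scale `γ_k(t) = ⌊β_k γ(t)⌋`. -/
def timeScale (β : ℕ → ℝ) (γ : StieltjesFunction ℝ) (k : ℕ) (t : ℝ) : ℕ :=
  ⌊β k * γ t⌋₊

/-- The left limit `γ_k(s-)`. -/
def timeScaleLeft (β : ℕ → ℝ) (γ : StieltjesFunction ℝ) (k : ℕ) (s : ℝ) : ℕ :=
  Function.leftLim (timeScale β γ k) s

/-- `γ_k⁻¹(i) = inf {s ≥ 0 : γ_k(s) ≥ i}`. -/
def timeScaleInv (β : ℕ → ℝ) (γ : StieltjesFunction ℝ) (k i : ℕ) : ℝ :=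
  sInf {s : ℝ | 0 ≤ s ∧ i ≤ timeScale β γ k s}

/-- The discrete cumulant semigroup
`v_k(r, t; λ) = -k log g_{k, γ_k(r), γ_k(t)}(e^{-λ/k})`. -/
def cumulant (β : ℕ → ℝ) (γ : StieltjesFunction ℝ) (p : ℕ → ℕ → PMF ℕ)
    (k : ℕ) (r t lam : ℝ) : ℝ :=
  -(k : ℝ) * Real.log
    (multiPgf (p k) (timeScale β γ k r) (timeScale β γ k t) (Real.exp (-lam / k)))

/-- `J_k(r, t)`: the (finitely many) `s ∈ (r, t]` with `Δγ_k(s) = γ_k(s) - γ_k(s-) ≥ 1`. -/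
def jumpSet (β : ℕ → ℝ) (γ : StieltjesFunction ℝ) (k : ℕ) (r t : ℝ) : Set ℝ :=
  {s | s ∈ Ioc r t ∧ timeScaleLeft β γ k s + 1 ≤ timeScale β γ k s}

/-- `I_{k,s,1}(λ)`; the integral from `γ_k⁻¹(γ_k(s-))` to `s-` is over the open interval. -/
def err₁ (β : ℕ → ℝ) (γ : StieltjesFunction ℝ) (b₁ c : ℝ → ℝ) (m : Kernel ℝ ℝ)
    (p : ℕ → ℕ → PMF ℕ) (k : ℕ) (s lam : ℝ) : ℝ :=
  (k : ℝ) * (pgf (p k (timeScaleLeft β γ k s)) (1 - lam / k) - (1 - lam / k)) -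
    ∫ u in Ioo (timeScaleInv β γ k (timeScaleLeft β γ k s)) s, phi b₁ c m u lam ∂γ.measure

/-- `I_{k,s,2}(λ)`. -/
def err₂ (β : ℕ → ℝ) (γ : StieltjesFunction ℝ) (b₁ c : ℝ → ℝ) (m : Kernel ℝ ℝ)
    (p : ℕ → ℕ → PMF ℕ) (k : ℕ) (s lam : ℝ) : ℝ :=
  (k : ℝ) * (multiPgf (p k) (timeScaleLeft β γ k s + 1) (timeScale β γ k s) (1 - lam / k) -
      (1 - lam / k)) -
    phi b₁ c m s lam * γ.measure.real {s}

/-- `I_{k,s}(λ) = |I_{k,s,1}(λ)| + |I_{k,s,2}(λ)|`. -/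
def err (β : ℕ → ℝ) (γ : StieltjesFunction ℝ) (b₁ c : ℝ → ℝ) (m : Kernel ℝ ℝ)
    (p : ℕ → ℕ → PMF ℕ) (k : ℕ) (s lam : ℝ) : ℝ :=
  |err₁ β γ b₁ c m p k s lam| + |err₂ β γ b₁ c m p k s lam|

/-- Condition (A).  The bound is only required for `k ≥ M`, where the arguments `1 - λ/k`,
`λ ∈ [0, M]`, lie in `[0, 1]`, so that the generating functions are defined there.  (A monotone
right-continuous function is càdlàg.) -/
def ConditionA (β : ℕ → ℝ) (γ : StieltjesFunction ℝ) (b₁ c : ℝ → ℝ) (m : Kernel ℝ ℝ)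
    (p : ℕ → ℕ → PMF ℕ) : Prop :=
  ∀ M : ℝ, 0 < M → ∃ F : ℕ → ℝ → ℝ,
    (∀ k, 1 ≤ k →
      (∀ s, 0 ≤ s → 0 ≤ F k s) ∧
      MonotoneOn (F k) (Ici 0) ∧
      (∀ s, 0 ≤ s → ContinuousWithinAt (F k) (Ici s) s)) ∧
    (∀ s, 0 ≤ s → Tendsto (fun k => F k s) atTop (𝓝 0)) ∧
    ∀ T : ℝ, 0 ≤ T → ∀ lam : ℕ → ℝ → ℝ,
      (∀ k, 1 ≤ k → ∀ s ∈ Icc 0 T, lam k s ∈ Icc 0 M) →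
      ∀ k : ℕ, 1 ≤ k → M ≤ k → ∀ r t : ℝ, 0 ≤ r → r ≤ t → t ≤ T →
        ∑ᶠ s ∈ jumpSet β γ k r t, err β γ b₁ c m p k s (lam k s) ≤ F k t - F k r

end GWVE

end

/-!
In the scaled variable `x = k (1 - z)`, `z ∈ [0, 1]`, a composition of generating functions maps
`[0, k]` to itself, and `x ≤ -k log z ≤ 2 x` while `x ≤ k / 2`.  So it suffices to bound
`x_r = k (1 - g_{k, γ_k(r), γ_k(t)}(z))` for `z = e^{-λ/k}`, starting from `x_t = k (1 - z)`, which
lies in `[λ/2, λ]`.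

Going backwards over one jump `s` of `γ_k` (`NextJump.recursion`), `x` is first replaced by
`x - φ(s, x) γ({s})`, then by `x - ∫ φ(u, x) γ(du)` over the open interval between the previous
jump and `s`, each time up to an error that condition (A) controls in sum.

* Upper bound: `φ(s, x) ≥ -D (1 + x)` (`CoeffBound.neg_le_phi`), so a Gronwall argument for `1 + x`
  keeps `x` below a constant `M` that depends on `b`, `D` and `γ(T)` only.
* Lower bound: on `[0, M]` one has `φ(s, x) ≤ C x` (`CoeffBound.phi_le`).  The open intervals have
  `γ`-mass at most `1 / β_k`, so there the step multiplies `x` by at least `e^{-2 C γ(du)}`, and the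
  same holds at atoms with `C γ({s})` small.  The remaining atoms are finite in number, and at each
  of them `x ↦ x - φ(s, x) γ({s})` is concave, zero at zero and positive on `(0, M]`, hence at
  least `κ x` with `κ > 0` (`Admissible.exists_pos_mul_le_sub_phi`).  This is where the conditions
  on the jumps of `γ` enter.  Altogether `x_r ≥ e^{-R} x_t - (sum of errors)`, with `R`
  independent of `k`, and the sum of errors tends to `0`.

Both bounds are carried through one induction in `scaled_pgf_bounds`.  The mass of `γ` used so far
is tracked by `γ(γ_k⁻¹(γ_k(r)))`, which telescopes over the jumps.
-/

namespace GWVE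

/-! ### Generating functions and their compositions -/

theorem pgf_mem_Icc (p : PMF ℕ) {z : ℝ} (hz : z ∈ Icc (0 : ℝ) 1) : pgf p z ∈ Icc (0 : ℝ) 1 := by
  have hs : Summable fun j => (p j).toReal := ENNReal.summable_toReal p.tsum_coe_ne_top
  have h1 : ∑' j, (p j).toReal = 1 := by
    rw [← ENNReal.tsum_toReal_eq (fun j => p.apply_ne_top j), p.tsum_coe]
    rfl
  have hle : ∀ j, (p j).toReal * z ^ j ≤ (p j).toReal := fun j =>
    mul_le_of_le_one_right ENNReal.toReal_nonneg (pow_le_one₀ hz.1 hz.2)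
  have hnn : ∀ j, 0 ≤ (p j).toReal * z ^ j := fun j =>
    mul_nonneg ENNReal.toReal_nonneg (pow_nonneg hz.1 j)
  refine ⟨tsum_nonneg hnn, ?_⟩
  rw [← h1]
  exact (Summable.of_nonneg_of_le hnn hle hs).tsum_le_tsum hle hs

theorem compFrom_add (g : ℕ → ℝ → ℝ) (i d e : ℕ) (z : ℝ) :
    compFrom g i (d + e) z = compFrom g i d (compFrom g (i + d) e z) := by
  induction d generalizing i with
  | zero => simp [compFrom]
  | succ d ih =>
    rw [show d + 1 + e = (d + e) + 1 by ring, compFrom, compFrom, ih,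
      show i + 1 + d = i + (d + 1) by ring]

theorem multiPgf_self (p : ℕ → PMF ℕ) (i : ℕ) (z : ℝ) : multiPgf p i i z = z := by
  simp [multiPgf, compFrom]

theorem multiPgf_trans (p : ℕ → PMF ℕ) {i j n : ℕ} (hij : i ≤ j) (hjn : j ≤ n) (z : ℝ) :
    multiPgf p i n z = multiPgf p i j (multiPgf p j n z) := by
  unfold multiPgf
  rw [show n - i = (j - i) + (n - j) by omega, compFrom_add, show i + (j - i) = j by omega]

theorem multiPgf_of_lt (p : ℕ → PMF ℕ) {i n : ℕ} (hin : i < n) (z : ℝ) :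
    multiPgf p i n z = pgf (p i) (multiPgf p (i + 1) n z) := by
  unfold multiPgf
  rw [show n - i = (n - (i + 1)) + 1 by omega, compFrom]

theorem multiPgf_mem_Icc (p : ℕ → PMF ℕ) (i n : ℕ) {z : ℝ} (hz : z ∈ Icc (0 : ℝ) 1) :
    multiPgf p i n z ∈ Icc (0 : ℝ) 1 := by
  unfold multiPgf
  generalize n - i = d
  induction d generalizing i with
  | zero => exact hz
  | succ d ih => exact pgf_mem_Icc _ (ih (i + 1))

/-! ### Bounds on the branching mechanism -/

theorem measurable_K₁ (x : ℝ) : Measurable (K₁ x) := by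
  unfold K₁
  refine Measurable.add (by fun_prop) (Measurable.ite measurableSet_Iic (by fun_prop) (by fun_prop))

theorem neg_min_le_K₁ {x z : ℝ} : -(min 1 (z ^ 2)) ≤ K₁ x z := by
  unfold K₁
  split_ifs with h
  · have := Real.add_one_le_exp (-x * z)
    have : 0 ≤ min 1 (z ^ 2) := le_min zero_le_one (sq_nonneg z)
    linarith
  · have := Real.exp_pos (-x * z)
    rw [min_eq_left (by nlinarith)]
    linarith

/-- `e^{-u} ≤ 1 - u + u²` for `u ≥ 0`. -/
theorem exp_neg_le {u : ℝ} (hu : 0 ≤ u) : Real.exp (-u) ≤ 1 - u + u ^ 2 := by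
  have h1 : u + 1 ≤ Real.exp u := Real.add_one_le_exp u
  have h2 : Real.exp (-u) * Real.exp u = 1 := by rw [← Real.exp_add]; simp
  have h3 := Real.exp_pos (-u)
  have h4 : Real.exp (-u) * (u + 1) ≤ 1 := by nlinarith
  nlinarith [mul_nonneg hu (sq_nonneg u)]

theorem exp_neg_two_mul_le {u : ℝ} (hu : 0 ≤ u) (hu' : u ≤ 1 / 4) :
    Real.exp (-(2 * u)) ≤ 1 - u := by
  have := exp_neg_le (u := 2 * u) (by linarith)
  nlinarith

theorem K₁_le {x z : ℝ} (hx : 0 ≤ x) (hz : 0 < z) : K₁ x z ≤ x ^ 2 * min 1 (z ^ 2) := by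
  have hxz : 0 ≤ x * z := mul_nonneg hx hz.le
  unfold K₁
  split_ifs with h
  · rw [min_eq_right (by nlinarith)]
    have := exp_neg_le hxz
    rw [neg_mul]
    nlinarith
  · have h1 : Real.exp (-x * z) ≤ 1 := Real.exp_le_one_iff.2 (by linarith)
    have : 0 ≤ x ^ 2 * min 1 (z ^ 2) := by positivity
    linarith

/-- `D` bounds `|b₁|`, `|c|` and `∫ (1 ∧ z²) m(s, dz)` at all times `s ≥ 0`. -/
def CoeffBound (b₁ c : ℝ → ℝ) (m : Kernel ℝ ℝ) (D : ℝ) : Prop :=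
  ∀ s, 0 ≤ s → |b₁ s| ≤ D ∧ |c s| ≤ D ∧
    IntegrableOn (fun z : ℝ => min 1 (z ^ 2)) (Ioi 0) (m s) ∧
    ∫ z in Ioi (0 : ℝ), min 1 (z ^ 2) ∂(m s) ≤ D

theorem Admissible.exists_coeffBound {γ : StieltjesFunction ℝ} {b₁ c : ℝ → ℝ} {m : Kernel ℝ ℝ}
    (h : Admissible γ b₁ c m) : ∃ D : ℝ, 0 < D ∧ CoeffBound b₁ c m D := by
  obtain ⟨Cb, hb⟩ := h.bounded_b₁
  obtain ⟨Cc, hc⟩ := h.bounded_c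
  obtain ⟨Cm, hm⟩ := h.bounded_m
  have hCb := le_abs_self Cb
  have hCc := le_abs_self Cc
  have hCm := le_abs_self Cm
  have hCb' := abs_nonneg Cb
  have hCc' := abs_nonneg Cc
  have hCm' := abs_nonneg Cm
  refine ⟨|Cb| + |Cc| + |Cm| + 1, by positivity, fun s hs => ?_⟩
  have hb := hb s hs
  have hc := hc s hs
  have hm := hm s hs
  have hnn : ∀ z : ℝ, 0 ≤ min 1 (z ^ 2) := fun z => le_min zero_le_one (sq_nonneg z)
  have hmeas : AEStronglyMeasurable (fun z : ℝ => min 1 (z ^ 2)) ((m s).restrict (Ioi 0)) := by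
    fun_prop
  refine ⟨by linarith, by linarith, ⟨hmeas, ?_⟩, ?_⟩
  · rw [hasFiniteIntegral_iff_ofReal (Eventually.of_forall hnn)]
    exact hm.trans_lt ENNReal.ofReal_lt_top
  · rw [integral_eq_lintegral_of_nonneg_ae (Eventually.of_forall hnn) hmeas]
    have : (∫⁻ z in Ioi (0 : ℝ), ENNReal.ofReal (min 1 (z ^ 2)) ∂(m s)).toReal
        ≤ (ENNReal.ofReal |Cm|).toReal :=
      ENNReal.toReal_mono ENNReal.ofReal_ne_top (hm.trans (ENNReal.ofReal_le_ofReal hCm))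
    rw [ENNReal.toReal_ofReal hCm'] at this
    linarith

theorem CoeffBound.integrableOn_K₁ {b₁ c : ℝ → ℝ} {m : Kernel ℝ ℝ} {D : ℝ}
    (hD : CoeffBound b₁ c m D) {s x : ℝ} (hs : 0 ≤ s) (hx : 0 ≤ x) :
    IntegrableOn (K₁ x) (Ioi 0) (m s) := by
  refine Integrable.mono' ((hD s hs).2.2.1.const_mul (1 + x ^ 2))
    (measurable_K₁ x).aestronglyMeasurable ?_
  filter_upwards [ae_restrict_mem measurableSet_Ioi] with z hz
  have h1 := neg_min_le_K₁ (x := x) (z := z)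
  have h2 := K₁_le hx hz
  have h3 : 0 ≤ min 1 (z ^ 2) := le_min zero_le_one (sq_nonneg z)
  rw [Real.norm_eq_abs, abs_le]
  constructor <;> nlinarith [mul_nonneg (sq_nonneg x) h3]

theorem CoeffBound.neg_le_phi {b₁ c : ℝ → ℝ} {m : Kernel ℝ ℝ} {D : ℝ}
    (hD : CoeffBound b₁ c m D) (hc : ∀ s, 0 ≤ s → 0 ≤ c s) {s x : ℝ} (hs : 0 ≤ s) (hx : 0 ≤ x) :
    -(D * (1 + x)) ≤ phi b₁ c m s x := by
  obtain ⟨h1, -, h3, h4⟩ := hD s hs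
  have h5 : -∫ z in Ioi (0 : ℝ), min 1 (z ^ 2) ∂(m s) ≤ ∫ z in Ioi (0 : ℝ), K₁ x z ∂(m s) := by
    rw [← integral_neg]
    exact integral_mono h3.neg (hD.integrableOn_K₁ hs hx) fun z => neg_min_le_K₁
  have h6 : -D * x ≤ b₁ s * x := mul_le_mul_of_nonneg_right (abs_le.1 h1).1 hx
  have h7 := mul_nonneg (hc s hs) (sq_nonneg x)
  unfold phi
  linarith

theorem CoeffBound.phi_le {b₁ c : ℝ → ℝ} {m : Kernel ℝ ℝ} {D : ℝ}
    (hD : CoeffBound b₁ c m D) {s x M : ℝ} (hs : 0 ≤ s) (hx : 0 ≤ x) (hxM : x ≤ M) :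
    phi b₁ c m s x ≤ D * (1 + 2 * M) * x := by
  obtain ⟨h1, h2, h3, h4⟩ := hD s hs
  have hD0 : 0 ≤ D := (abs_nonneg _).trans h1
  have h5 : ∫ z in Ioi (0 : ℝ), K₁ x z ∂(m s) ≤
      ∫ z in Ioi (0 : ℝ), x ^ 2 * min 1 (z ^ 2) ∂(m s) :=
    setIntegral_mono_on (hD.integrableOn_K₁ hs hx) (h3.const_mul _) measurableSet_Ioi
      fun z hz => K₁_le hx hz
  rw [integral_const_mul] at h5
  have h6 : b₁ s * x ≤ D * x := mul_le_mul_of_nonneg_right (abs_le.1 h1).2 hx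
  have h7 : c s * x ^ 2 ≤ D * x ^ 2 := mul_le_mul_of_nonneg_right (abs_le.1 h2).2 (sq_nonneg x)
  have h8 := mul_le_mul_of_nonneg_left h4 (sq_nonneg x)
  have h9 : D * x ^ 2 ≤ D * M * x := by
    nlinarith [mul_le_mul_of_nonneg_left hxM (mul_nonneg hD0 hx)]
  unfold phi
  nlinarith

/-- A constant upper bound on the integrand bounds the integral over a set of finite measure; if
the integrand is not integrable the integral is `0`, whence the assumption `0 ≤ C`. -/
theorem setIntegral_le_of_le_const {μ : Measure ℝ} {S : Set ℝ} {f : ℝ → ℝ} {C : ℝ}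
    (hS : MeasurableSet S) (hfin : μ S ≠ ⊤) (hC : 0 ≤ C) (hf : ∀ u ∈ S, f u ≤ C) :
    ∫ u in S, f u ∂μ ≤ C * μ.real S := by
  by_cases hi : IntegrableOn f S μ
  · calc ∫ u in S, f u ∂μ ≤ ∫ _ in S, C ∂μ :=
          setIntegral_mono_on hi (integrableOn_const hfin) hS hf
      _ = C * μ.real S := by simp [mul_comm]
  · rw [integral_undef hi]
    exact mul_nonneg hC measureReal_nonneg

/-! ### Atoms of the time change -/

theorem one_sub_exp_neg_nonneg {u : ℝ} (hu : 0 ≤ u) : 0 ≤ 1 - Real.exp (-u) :=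
  sub_nonneg.2 (Real.exp_le_one_iff.2 (by linarith))

/-- By concavity, the graph of `x ↦ 1 - e^{-xz}` lies above its chord over `[0, M]`. -/
theorem chord_le_one_sub_exp {x M z : ℝ} (hx : 0 ≤ x) (hxM : x ≤ M) (hM : 0 < M) :
    x / M * (1 - Real.exp (-(M * z))) ≤ 1 - Real.exp (-(x * z)) := by
  have h := convexOn_exp.2 (mem_univ (0 : ℝ)) (mem_univ (-(M * z)))
    (sub_nonneg.2 ((div_le_one hM).2 hxM)) (div_nonneg hx hM.le) (sub_add_cancel 1 (x / M))
  have e : (1 - x / M) • (0 : ℝ) + (x / M) • (-(M * z)) = -(x * z) := by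
    simp only [smul_eq_mul]
    field_simp
    ring
  rw [e] at h
  simp only [smul_eq_mul, Real.exp_zero] at h
  linarith

/-- At an atom `s` of `γ` the limiting one-step map `x ↦ x - φ(s, x) γ({s})` equals
`x [1 - (b₁(s) + ∫_{(0,1]} z m(s, dz)) γ({s})] + γ({s}) ∫ (1 - e^{-xz}) m(s, dz)`.  Both terms are
nonnegative by `jump_le_one`, they do not vanish together by `big_jumps`, and the second is concave
in `x`; so on `[0, M]` the map is bounded below by a linear function with positive slope. -/
theorem Admissible.exists_pos_mul_le_sub_phi {γ : StieltjesFunction ℝ} {b₁ c : ℝ → ℝ}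
    {m : Kernel ℝ ℝ} (h : Admissible γ b₁ c m) {D M s : ℝ} (hD : CoeffBound b₁ c m D)
    (hM : 0 < M) (hs : 0 < s) (hq : 0 < γ.measure.real {s}) :
    ∃ κ : ℝ, 0 < κ ∧ ∀ x, 0 ≤ x → x ≤ M →
      κ * x ≤ x - phi b₁ c m s x * γ.measure.real {s} := by
  set q := γ.measure.real {s} with hqdef
  obtain ⟨hz, hle⟩ := h.jump_le_one s hs hq
  have hcq : c s * q = 0 := h.c_atom s hs
  set ζ := ∫ z in Ioc (0 : ℝ) 1, z ∂(m s) with hζ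
  -- `z 1_{z ≤ 1}` as an integrable function on `(0,∞)`
  have hite : IntegrableOn (fun z : ℝ => if z ≤ 1 then z else 0) (Ioi 0) (m s) ∧
      ∫ z in Ioi (0 : ℝ), (if z ≤ 1 then z else 0) ∂(m s) = ζ := by
    have e : (fun z : ℝ => if z ≤ 1 then z else 0) = (Iic (1 : ℝ)).indicator fun z => z := by
      ext z
      simp [indicator]
    rw [e]
    constructor
    · rw [IntegrableOn, integrable_indicator_iff measurableSet_Iic, IntegrableOn,
        Measure.restrict_restrict measurableSet_Iic, inter_comm, Ioi_inter_Iic]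
      exact hz
    · rw [integral_indicator measurableSet_Iic, Measure.restrict_restrict measurableSet_Iic,
        inter_comm, Ioi_inter_Iic]
  have hHint : ∀ x, 0 ≤ x → IntegrableOn (fun z : ℝ => 1 - Real.exp (-(x * z))) (Ioi 0) (m s) := by
    intro x hx
    have := (hite.1.const_mul x).sub (hD.integrableOn_K₁ hs.le hx)
    refine this.congr (Eventually.of_forall fun z => ?_)
    simp only [K₁, Pi.sub_apply]
    split_ifs <;> simp
  have hphi : ∀ x, 0 ≤ x → ∫ z in Ioi (0 : ℝ), K₁ x z ∂(m s) =
      x * ζ - ∫ z in Ioi (0 : ℝ), (1 - Real.exp (-(x * z))) ∂(m s) := by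
    intro x hx
    rw [← hite.2, ← integral_const_mul, ← integral_sub (hite.1.const_mul x) (hHint x hx)]
    refine integral_congr_ae (Eventually.of_forall fun z => ?_)
    simp only [K₁, neg_mul]
    split_ifs <;> ring
  set H := ∫ z in Ioi (0 : ℝ), (1 - Real.exp (-(M * z))) ∂(m s) with hH
  have hnn : 0 ≤ᵐ[(m s).restrict (Ioi 0)] fun z : ℝ => 1 - Real.exp (-(M * z)) := by
    filter_upwards [ae_restrict_mem measurableSet_Ioi] with z hz
    exact one_sub_exp_neg_nonneg (mul_nonneg hM.le (le_of_lt hz))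
  have hH0 : 0 ≤ H := integral_nonneg_of_ae hnn
  refine ⟨(1 - (b₁ s + ζ) * q) + q * (H / M), ?_, fun x hx hxM => ?_⟩
  · by_contra hneg
    have h1 : 0 ≤ q * (H / M) := by positivity
    have hα : (b₁ s + ζ) * q = 1 := by linarith
    have hH1 : H = 0 := by
      by_contra hne
      have : 0 < q * (H / M) := by have := lt_of_le_of_ne hH0 (Ne.symm hne); positivity
      linarith
    -- `H = 0` forces `m(s, (0,∞)) = 0`, so `b₁(s) γ({s}) = 1` without large jumps
    have hm0 : m s (Ioi 0) = 0 := by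
      have := (integral_eq_zero_iff_of_nonneg_ae hnn (hHint M hM.le)).1 hH1
      rw [← Measure.restrict_eq_zero, ← ae_eq_bot, ← Filter.eventually_false_iff_eq_bot]
      filter_upwards [this, ae_restrict_mem measurableSet_Ioi] with z h2 h3
      have h4 : Real.exp (-(M * z)) < 1 :=
        Real.exp_lt_one_iff.2 (by linarith [mul_pos hM (mem_Ioi.1 h3)])
      simp only [Pi.zero_apply] at h2
      linarith
    have hζ0 : ζ = 0 := by
      rw [hζ, Measure.restrict_eq_zero.2 (measure_mono_null Ioc_subset_Ioi_self hm0),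
        integral_zero_measure]
    rw [hζ0, add_zero] at hα
    have := h.big_jumps s hs hα
    rw [measure_mono_null (Ioi_subset_Ioi zero_le_one) hm0, zero_mul] at this
    exact lt_irrefl _ this
  · have h1 : x / M * H ≤ ∫ z in Ioi (0 : ℝ), (1 - Real.exp (-(x * z))) ∂(m s) := by
      rw [hH, ← integral_const_mul]
      exact integral_mono ((hHint M hM.le).const_mul _) (hHint x hx)
        fun z => chord_le_one_sub_exp hx hxM hM
    have h2 : x - phi b₁ c m s x * q = (1 - (b₁ s + ζ) * q) * x - c s * q * x ^ 2
        + q * ∫ z in Ioi (0 : ℝ), (1 - Real.exp (-(x * z))) ∂(m s) := by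
      unfold phi
      rw [hphi x hx]
      ring
    rw [h2, hcq]
    have h3 := mul_le_mul_of_nonneg_left h1 hq.le
    have h4 : (1 - (b₁ s + ζ) * q + q * (H / M)) * x =
      (1 - (b₁ s + ζ) * q) * x + q * (x / M * H) := by ring
    linarith

theorem finite_atoms_ge (γ : StieltjesFunction ℝ) (T : ℝ) {δ : ℝ} (hδ : 0 < δ) :
    {s | s ∈ Ioc 0 T ∧ δ ≤ γ.measure.real {s}}.Finite := by
  by_contra hinf
  obtain ⟨n, hn⟩ := exists_nat_gt (γ.measure.real (Ioc 0 T) / δ)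
  obtain ⟨S, hS, hcard⟩ := Set.Infinite.exists_subset_card_eq hinf n
  have h1 : ∑ s ∈ S, γ.measure.real {s} = γ.measure.real (S : Set ℝ) :=
    sum_measureReal_singleton S
  have h2 : γ.measure.real (S : Set ℝ) ≤ γ.measure.real (Ioc 0 T) :=
    measureReal_mono (fun s hs => (hS hs).1) (by simp)
  have h3 : S.card • δ ≤ ∑ s ∈ S, γ.measure.real {s} :=
    Finset.card_nsmul_le_sum _ _ _ fun s hs => (hS hs).2
  rw [hcard, nsmul_eq_mul] at h3
  rw [div_lt_iff₀ hδ] at hn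
  linarith

/-- On `[0, M]` the limiting one-step map at `s` shrinks its argument at most by the factor
`e^{-2C γ({s}) - ρ(s)}`, where `C = D (1 + 2M)` bounds `φ(s, x) / x` and `ρ` is supported on the
finite set `S` of atoms of mass at least `1 / (4C)`. -/
theorem Admissible.exists_atom_lower_bound {γ : StieltjesFunction ℝ} {b₁ c : ℝ → ℝ}
    {m : Kernel ℝ ℝ} (h : Admissible γ b₁ c m) {D M : ℝ} (hD0 : 0 < D)
    (hD : CoeffBound b₁ c m D) (hM : 0 < M) (T : ℝ) :
    ∃ (S : Finset ℝ) (ρ : ℝ → ℝ), (∀ s, 0 ≤ ρ s) ∧ (∀ s, s ∉ S → ρ s = 0) ∧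
      ∀ s, 0 < s → s ≤ T → ∀ x, 0 ≤ x → x ≤ M →
        Real.exp (-(2 * (D * (1 + 2 * M)) * γ.measure.real {s} + ρ s)) * x ≤
          x - phi b₁ c m s x * γ.measure.real {s} := by
  classical
  set C := D * (1 + 2 * M) with hC
  have hC0 : 0 < C := by positivity
  have hδ : 0 < 1 / (4 * C) := by positivity
  have hfin := finite_atoms_ge γ T hδ
  have hκ : ∀ s, ∃ κ : ℝ, 0 < κ ∧ (s ∈ hfin.toFinset → ∀ x, 0 ≤ x → x ≤ M →
      κ * x ≤ x - phi b₁ c m s x * γ.measure.real {s}) := by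
    intro s
    by_cases hs : s ∈ hfin.toFinset
    · have hs' := hfin.mem_toFinset.1 hs
      obtain ⟨κ, h1, h2⟩ := h.exists_pos_mul_le_sub_phi hD hM hs'.1.1 (hδ.trans_le hs'.2)
      exact ⟨κ, h1, fun _ => h2⟩
    · exact ⟨1, one_pos, fun h => absurd h hs⟩
  choose κ hκ0 hκ using hκ
  refine ⟨hfin.toFinset, fun s => if s ∈ hfin.toFinset then |Real.log (κ s)| else 0,
    fun s => by dsimp only; split_ifs <;> positivity, fun s hs => if_neg hs,
    fun s hs hsT x hx hxM => ?_⟩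
  have hq : 0 ≤ γ.measure.real {s} := measureReal_nonneg
  by_cases hS : s ∈ hfin.toFinset
  · simp only [hS, if_true]
    refine le_trans (mul_le_mul_of_nonneg_right ?_ hx) (hκ s hS x hx hxM)
    rw [← Real.le_log_iff_exp_le (hκ0 s)]
    have := neg_abs_le (Real.log (κ s))
    have : 0 ≤ 2 * C * γ.measure.real {s} := by positivity
    linarith
  · simp only [hS, if_false, add_zero]
    have hlt : γ.measure.real {s} < 1 / (4 * C) := by
      by_contra hge
      exact hS (hfin.mem_toFinset.2 ⟨⟨hs, hsT⟩, not_lt.1 hge⟩)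
    rw [lt_div_iff₀ (by positivity)] at hlt
    have h2 : phi b₁ c m s x * γ.measure.real {s} ≤ C * x * γ.measure.real {s} :=
      mul_le_mul_of_nonneg_right (hD.phi_le hs.le hx hxM) hq
    have h3 : Real.exp (-(2 * C * γ.measure.real {s})) ≤ 1 - C * γ.measure.real {s} := by
      rw [mul_assoc]
      exact exp_neg_two_mul_le (by positivity) (by linarith)
    nlinarith [mul_le_mul_of_nonneg_right h3 hx]

/-! ### The jumps of the discrete time scale -/

theorem monotone_timeScale {β : ℕ → ℝ} (γ : StieltjesFunction ℝ) {k : ℕ} (hβ : 0 < β k) :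
    Monotone (timeScale β γ k) := fun _ _ h =>
  Nat.floor_mono (mul_le_mul_of_nonneg_left (γ.mono h) hβ.le)

theorem nonneg_of_zero {γ : StieltjesFunction ℝ} (h0 : γ 0 = 0) {s : ℝ} (hs : 0 ≤ s) : 0 ≤ γ s :=
  h0 ▸ γ.mono hs

theorem timeScaleInv_nonneg (β : ℕ → ℝ) (γ : StieltjesFunction ℝ) (k i : ℕ) :
    0 ≤ timeScaleInv β γ k i :=
  Real.sInf_nonneg fun _ h => h.1

theorem timeScaleInv_le {β : ℕ → ℝ} {γ : StieltjesFunction ℝ} {k i : ℕ} {s : ℝ} (hs : 0 ≤ s)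
    (hi : i ≤ timeScale β γ k s) : timeScaleInv β γ k i ≤ s :=
  csInf_le ⟨0, fun _ h => h.1⟩ ⟨hs, hi⟩

theorem timeScale_lt_of_lt_timeScaleInv {β : ℕ → ℝ} {γ : StieltjesFunction ℝ} {k i : ℕ} {s : ℝ}
    (hs : 0 ≤ s) (hi : s < timeScaleInv β γ k i) : timeScale β γ k s < i := by
  by_contra h
  exact absurd (timeScaleInv_le hs (not_lt.1 h)) (not_le.2 hi)

/-- The infimum defining `γ_k⁻¹(i)` is attained, by right continuity of `γ`. -/
theorem le_timeScale_timeScaleInv {β : ℕ → ℝ} {γ : StieltjesFunction ℝ} (h0 : γ 0 = 0) {k i : ℕ}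
    (hβ : 0 < β k) {t : ℝ} (ht : 0 ≤ t) (hi : i ≤ timeScale β γ k t) :
    i ≤ timeScale β γ k (timeScaleInv β γ k i) := by
  have ha := timeScaleInv_nonneg β γ k i
  refine Nat.le_floor ?_
  have hlim : Tendsto (fun u => β k * γ u) (𝓝[>] (timeScaleInv β γ k i))
      (𝓝 (β k * γ (timeScaleInv β γ k i))) :=
    (((γ.right_continuous _).mono Ioi_subset_Ici_self).tendsto).const_mul _
  refine ge_of_tendsto hlim ?_
  filter_upwards [self_mem_nhdsWithin] with u hu
  have hne : {s : ℝ | 0 ≤ s ∧ i ≤ timeScale β γ k s}.Nonempty := ⟨t, ht, hi⟩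
  obtain ⟨v, hv, hvu⟩ := exists_lt_of_csInf_lt hne (mem_Ioi.1 hu)
  have h1 : i ≤ timeScale β γ k u := hv.2.trans (monotone_timeScale γ hβ hvu.le)
  exact (Nat.le_floor_iff (mul_nonneg hβ.le (nonneg_of_zero h0 (hv.1.trans hvu.le)))).1 h1

/-- `s` is the first jump time of `γ_k` after `r`. -/
structure NextJump (β : ℕ → ℝ) (γ : StieltjesFunction ℝ) (k : ℕ) (r s : ℝ) : Prop where
  lt : r < s
  left_eq : timeScaleLeft β γ k s = timeScale β γ k r
  jump : timeScale β γ k r + 1 ≤ timeScale β γ k s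

theorem exists_nextJump {β : ℕ → ℝ} {γ : StieltjesFunction ℝ} (h0 : γ 0 = 0) {k : ℕ}
    (hβ : 0 < β k) {r t : ℝ} (hr : 0 ≤ r) (hrt : r ≤ t)
    (h : timeScale β γ k r < timeScale β γ k t) : ∃ s, s ≤ t ∧ NextJump β γ k r s := by
  have ht := hr.trans hrt
  have hmono := monotone_timeScale γ hβ
  have hjump : timeScale β γ k r + 1 ≤ _ := le_timeScale_timeScaleInv h0 hβ ht h
  have hlt : r < timeScaleInv β γ k (timeScale β γ k r + 1) := by
    by_contra hle
    have := hmono (not_lt.1 hle)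
    omega
  refine ⟨_, timeScaleInv_le ht (Nat.succ_le_of_lt h), hlt, ?_, hjump⟩
  refine leftLim_eq_of_tendsto (tendsto_const_nhds.congr' ?_)
  filter_upwards [Ico_mem_nhdsLT hlt] with u hu
  have h1 := timeScale_lt_of_lt_timeScaleInv (hr.trans hu.1) hu.2
  have h2 := hmono hu.1
  omega

/-- Backward induction over the jump times of `γ_k` in `(0, t]`. -/
theorem jump_induction {β : ℕ → ℝ} {γ : StieltjesFunction ℝ} (h0 : γ 0 = 0) {k : ℕ}
    (hβ : 0 < β k) {t : ℝ} {P : ℝ → Prop}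
    (base : ∀ r, 0 ≤ r → r ≤ t → timeScale β γ k r = timeScale β γ k t → P r)
    (step : ∀ r s, 0 ≤ r → s ≤ t → NextJump β γ k r s → P s → P r) {r : ℝ} (hr : 0 ≤ r)
    (hrt : r ≤ t) : P r := by
  induction hn : timeScale β γ k t - timeScale β γ k r using Nat.strong_induction_on
    generalizing r with
  | _ n ih =>
    rcases (monotone_timeScale γ hβ hrt).eq_or_lt with h | h
    · exact base r hr hrt h
    · obtain ⟨s, hst, hs⟩ := exists_nextJump h0 hβ hr hrt h
      have h1 := hs.jump
      exact step r s hr hst hs (ih _ (by omega) (hr.trans hs.lt.le) hst rfl)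

theorem finite_jumpSet {β : ℕ → ℝ} (γ : StieltjesFunction ℝ) {k : ℕ} (hβ : 0 < β k) (r t : ℝ) :
    (jumpSet β γ k r t).Finite := by
  have hmono := monotone_timeScale γ hβ
  refine Set.Finite.of_finite_image ((finite_Iic (timeScale β γ k t)).subset ?_) (?_ :
    InjOn (timeScale β γ k) _)
  · rintro _ ⟨s, hs, rfl⟩
    exact hmono hs.1.2
  · have key : ∀ u ∈ jumpSet β γ k r t, ∀ v ∈ jumpSet β γ k r t, u < v →
        timeScale β γ k u < timeScale β γ k v := fun u _ v hv huv =>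
      (Nat.lt_succ_of_le (hmono.le_leftLim huv)).trans_le hv.2
    intro u hu v hv huv
    rcases lt_trichotomy u v with h | h | h
    · exact absurd huv (key u hu v hv h).ne
    · exact h
    · exact absurd huv (key v hv u hu h).ne'

theorem measureReal_Ioo_eq (γ : StieltjesFunction ℝ) {a s : ℝ} (h : a < s) :
    γ.measure.real (Ioo a s) = Function.leftLim γ s - γ a := by
  rw [measureReal_def, γ.measure_Ioo, ENNReal.toReal_ofReal (sub_nonneg.2 (γ.mono.le_leftLim h))]

theorem measureReal_singleton_eq (γ : StieltjesFunction ℝ) (s : ℝ) :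
    γ.measure.real {s} = γ s - Function.leftLim γ s := by
  rw [measureReal_def, γ.measure_singleton,
    ENNReal.toReal_ofReal (sub_nonneg.2 (γ.mono.leftLim_le le_rfl))]

namespace NextJump

variable {β : ℕ → ℝ} {γ : StieltjesFunction ℝ} {k : ℕ} {r s : ℝ}

theorem timeScaleInv_eq (h : NextJump β γ k r s) (hβ : 0 < β k) (hr : 0 ≤ r) :
    timeScaleInv β γ k (timeScale β γ k s) = s := by
  have hs := hr.trans h.lt.le
  refine le_antisymm (timeScaleInv_le hs le_rfl) (le_csInf ⟨s, hs, le_rfl⟩ fun u hu => ?_)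
  by_contra hlt
  have h1 : timeScale β γ k u ≤ timeScaleLeft β γ k s :=
    (monotone_timeScale γ hβ).le_leftLim (not_le.1 hlt)
  have h2 := hu.2
  have h3 := h.left_eq
  have h4 := h.jump
  omega

/-- Between two jumps of `γ_k` the measure `γ(du)` has mass at most `1 / β_k`. -/
theorem mul_measureReal_Ioo_le_one (h : NextJump β γ k r s) (h0 : γ 0 = 0) (hβ : 0 < β k)
    (hr : 0 ≤ r) :
    β k * γ.measure.real (Ioo (timeScaleInv β γ k (timeScale β γ k r)) s) ≤ 1 := by
  set a := timeScaleInv β γ k (timeScale β γ k r) with ha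
  have ha0 : 0 ≤ a := timeScaleInv_nonneg _ _ _ _
  have has : a < s := (timeScaleInv_le hr le_rfl).trans_lt h.lt
  rw [measureReal_Ioo_eq γ has, mul_sub]
  have h1 : (timeScale β γ k r : ℝ) ≤ β k * γ a :=
    (Nat.le_floor_iff (mul_nonneg hβ.le (nonneg_of_zero h0 ha0))).1
      (le_timeScale_timeScaleInv h0 hβ hr le_rfl)
  have h2 : β k * Function.leftLim γ s ≤ timeScale β γ k r + 1 := by
    refine le_of_tendsto ((γ.mono.tendsto_leftLim s).const_mul (β k)) ?_
    filter_upwards [self_mem_nhdsWithin] with u hu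
    have h3 : timeScale β γ k u ≤ timeScaleLeft β γ k s :=
      (monotone_timeScale γ hβ).le_leftLim hu
    rw [h.left_eq] at h3
    have h4 : β k * γ u < timeScale β γ k u + 1 := Nat.lt_floor_add_one _
    have h5 : (timeScale β γ k u : ℝ) ≤ timeScale β γ k r := by exact_mod_cast h3
    linarith
  linarith

theorem measureReal_add (h : NextJump β γ k r s) (hr : 0 ≤ r) :
    γ.measure.real (Ioo (timeScaleInv β γ k (timeScale β γ k r)) s) + γ.measure.real {s} =
      γ s - γ (timeScaleInv β γ k (timeScale β γ k r)) := by
  rw [measureReal_Ioo_eq γ ((timeScaleInv_le hr le_rfl).trans_lt h.lt), measureReal_singleton_eq]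
  ring

theorem mem_jumpSet (h : NextJump β γ k r s) (hr : 0 ≤ r) {T : ℝ} (hs : s ≤ T) :
    s ∈ jumpSet β γ k 0 T :=
  ⟨⟨hr.trans_lt h.lt, hs⟩, h.left_eq ▸ h.jump⟩

end NextJump

/-! ### The backward recursion -/

theorem add_sum_filter_lt_le {S : Finset ℝ} {f : ℝ → ℝ} (hf : ∀ u, 0 ≤ f u) {r s : ℝ} (hrs : r < s)
    (hs : s ∉ S → f s = 0) :
    f s + ∑ u ∈ S with s < u, f u ≤ ∑ u ∈ S with r < u, f u := by
  classical
  by_cases h : s ∈ S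
  · rw [← Finset.sum_insert (by simp : s ∉ S.filter (s < ·))]
    refine Finset.sum_le_sum_of_subset_of_nonneg (fun u hu => ?_) fun u _ _ => hf u
    rw [Finset.mem_insert, Finset.mem_filter] at hu
    rw [Finset.mem_filter]
    rcases hu with rfl | hu
    · exact ⟨h, hrs⟩
    · exact ⟨hu.1, hrs.trans hu.2⟩
  · rw [hs h, zero_add]
    refine Finset.sum_le_sum_of_subset_of_nonneg (fun u hu => ?_) fun u _ _ => hf u
    rw [Finset.mem_filter] at hu ⊢
    exact ⟨hu.1, hrs.trans hu.2⟩

theorem gronwall_upper_step {w w' A e u v : ℝ} (hw : w ≤ A * Real.exp u)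
    (hw' : w' ≤ w * (1 + v) + e) (hw0 : 0 ≤ w) (huv : 0 ≤ u + v) (he : 0 ≤ e) :
    w' ≤ (A + e) * Real.exp (u + v) := by
  have h1 : w * (1 + v) ≤ w * Real.exp v :=
    mul_le_mul_of_nonneg_left (by linarith [Real.add_one_le_exp v]) hw0
  have h2 : w * Real.exp v ≤ A * Real.exp u * Real.exp v :=
    mul_le_mul_of_nonneg_right hw (Real.exp_pos v).le
  have h3 : e ≤ e * Real.exp (u + v) := le_mul_of_one_le_right he (Real.one_le_exp huv)
  rw [mul_assoc, ← Real.exp_add] at h2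
  linarith

theorem gronwall_lower_step {x x' A E e u v : ℝ} (hx : Real.exp (-u) * A - E ≤ x)
    (hx' : Real.exp (-v) * x - e ≤ x') (hv : 0 ≤ v) (hE : 0 ≤ E) :
    Real.exp (-(u + v)) * A - (E + e) ≤ x' := by
  have h1 := mul_le_mul_of_nonneg_left hx (Real.exp_pos (-v)).le
  have h2 : Real.exp (-v) * E ≤ E := mul_le_of_le_one_left hE (Real.exp_le_one_iff.2 (by linarith))
  have h3 : Real.exp (-(u + v)) = Real.exp (-v) * Real.exp (-u) := by
    rw [← Real.exp_add]
    ring_nf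
  rw [h3, mul_assoc]
  linarith [mul_sub (Real.exp (-v)) (Real.exp (-u) * A) E]

/-- The two blocks of a jump of `γ_k` in the scaled variable `x = k (1 - z)`: the generations
`γ_k(s-) + 1, …, γ_k(s) - 1` reproduce the atom of `γ` at `s`, the generation `γ_k(s-)` the
mass of `γ` since the previous jump. -/
theorem NextJump.recursion {β : ℕ → ℝ} {γ : StieltjesFunction ℝ} {k : ℕ} {r s : ℝ}
    (h : NextJump β γ k r s) (hk : 0 < k) (b₁ c : ℝ → ℝ) (m : Kernel ℝ ℝ) (p : ℕ → ℕ → PMF ℕ)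
    {n : ℕ} (hn : timeScale β γ k s ≤ n) (z : ℝ) {X Y X' : ℝ}
    (hX : X = k * (1 - multiPgf (p k) (timeScale β γ k s) n z))
    (hY : Y = k * (1 - multiPgf (p k) (timeScaleLeft β γ k s + 1) n z))
    (hX' : X' = k * (1 - multiPgf (p k) (timeScale β γ k r) n z)) :
    Y = X - phi b₁ c m s X * γ.measure.real {s} - err₂ β γ b₁ c m p k s X ∧
    X' = Y - (∫ u in Ioo (timeScaleInv β γ k (timeScale β γ k r)) s, phi b₁ c m u Y ∂γ.measure) -
      err₁ β γ b₁ c m p k s Y := by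
  have hk' : (k : ℝ) ≠ 0 := by positivity
  have hj := h.jump
  have hX1 : 1 - X / k = multiPgf (p k) (timeScale β γ k s) n z := by
    rw [hX]; field_simp; ring
  have hY1 : 1 - Y / k = multiPgf (p k) (timeScaleLeft β γ k s + 1) n z := by
    rw [hY]; field_simp; ring
  constructor
  · rw [err₂, hX1, ← multiPgf_trans (p k) (h.left_eq ▸ hj) hn, hY]
    rw [hX]
    ring
  · rw [err₁, hY1, ← multiPgf_of_lt (p k) (by rw [h.left_eq]; omega), h.left_eq, hX']
    rw [hY, h.left_eq]
    ring

/-- Uniform bounds on `x_r = k (1 - g_{k, γ_k(r), γ_k(t)}(z))` in terms of `x_t = k (1 - z)`, by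
backward induction over the jumps of `γ_k`.  The upper bound keeps the `x_r` in `[0, M]`, where
the error bounds and the linear bounds on `φ` are available. -/
theorem scaled_pgf_bounds {γ : StieltjesFunction ℝ} {b₁ c : ℝ → ℝ} {m : Kernel ℝ ℝ}
    (hadm : Admissible γ b₁ c m) {β : ℕ → ℝ} {p : ℕ → ℕ → PMF ℕ} {D M T b ε : ℝ} (hD0 : 0 < D)
    (hD : CoeffBound b₁ c m D) (hM : (b + 2) * Real.exp (D * γ T) ≤ M) (hb : 0 < b)
    {S : Finset ℝ} {ρ : ℝ → ℝ} (hρ : ∀ s, 0 ≤ ρ s) (hρS : ∀ s, s ∉ S → ρ s = 0)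
    (hatom : ∀ s, 0 < s → s ≤ T → ∀ x, 0 ≤ x → x ≤ M →
        Real.exp (-(2 * (D * (1 + 2 * M)) * γ.measure.real {s} + ρ s)) * x ≤
          x - phi b₁ c m s x * γ.measure.real {s})
    {k : ℕ} (hk : 0 < k) (hβ : 0 < β k) (hβC : 4 * (D * (1 + 2 * M)) ≤ β k) (hε : 2 * ε ≤ 1)
    (herr : ∀ f : ℝ → ℝ, (∀ s, f s ∈ Icc 0 M) →
      ∑ s ∈ (finite_jumpSet γ hβ 0 T).toFinset, err β γ b₁ c m p k s (f s) ≤ ε)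
    {z : ℝ} (hz : z ∈ Icc (0 : ℝ) 1) (hzb : k * (1 - z) ≤ b) {r t : ℝ} (hr : 0 ≤ r) (hrt : r ≤ t)
    (ht : t ≤ T) :
    k * (1 - multiPgf (p k) (timeScale β γ k r) (timeScale β γ k t) z) ≤ M ∧
    Real.exp (-(2 * (D * (1 + 2 * M)) * γ T + ∑ s ∈ S, ρ s)) * (k * (1 - z)) - 2 * ε ≤
      k * (1 - multiPgf (p k) (timeScale β γ k r) (timeScale β γ k t) z) := by
  have h0 := hadm.γ_zero
  have ht0 := hr.trans hrt
  have hγT : 0 ≤ γ T := nonneg_of_zero h0 (ht0.trans ht)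
  have hM0 : 0 < M := lt_of_lt_of_le (by positivity) hM
  have hmono := monotone_timeScale γ hβ
  set n := timeScale β γ k t with hn
  set C := D * (1 + 2 * M) with hC
  have hC0 : 0 < C := by positivity
  set x₀ := k * (1 - z) with hx₀
  have hx₀0 : 0 ≤ x₀ := mul_nonneg (Nat.cast_nonneg k) (sub_nonneg.2 hz.2)
  set X : ℝ → ℝ := fun s => k * (1 - multiPgf (p k) (timeScale β γ k s) n z) with hXdef
  set Y : ℝ → ℝ := fun s => k * (1 - multiPgf (p k) (timeScaleLeft β γ k s + 1) n z) with hYdef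
  have hX0 : ∀ s, 0 ≤ X s := fun s =>
    mul_nonneg (Nat.cast_nonneg k) (sub_nonneg.2 (multiPgf_mem_Icc _ _ _ hz).2)
  have hY0 : ∀ s, 0 ≤ Y s := fun s =>
    mul_nonneg (Nat.cast_nonneg k) (sub_nonneg.2 (multiPgf_mem_Icc _ _ _ hz).2)
  -- `min M` makes the error bounds applicable before `X, Y ≤ M` is known
  set e₁ : ℝ → ℝ := fun s => |err₁ β γ b₁ c m p k s (min (Y s) M)| with he₁
  set e₂ : ℝ → ℝ := fun s => |err₂ β γ b₁ c m p k s (min (X s) M)| with he₂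
  set J := (finite_jumpSet γ hβ 0 T).toFinset with hJ
  set e : ℝ → ℝ := fun s => e₁ s + e₂ s with he
  have he₁0 : ∀ s, 0 ≤ e₁ s := fun s => abs_nonneg _
  have he₂0 : ∀ s, 0 ≤ e₂ s := fun s => abs_nonneg _
  have he0 : ∀ s, 0 ≤ e s := fun s => add_nonneg (he₁0 s) (he₂0 s)
  have hesum : ∑ s ∈ J, e s ≤ 2 * ε := by
    have h1 := herr (fun s => min (Y s) M) fun s => ⟨le_min (hY0 s) hM0.le, min_le_right _ _⟩
    have h2 := herr (fun s => min (X s) M) fun s => ⟨le_min (hX0 s) hM0.le, min_le_right _ _⟩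
    have h3 : ∑ s ∈ J, e₁ s ≤ ε :=
      (Finset.sum_le_sum fun s _ => le_add_of_nonneg_right (abs_nonneg _)).trans h1
    have h4 : ∑ s ∈ J, e₂ s ≤ ε :=
      (Finset.sum_le_sum fun s _ => le_add_of_nonneg_left (abs_nonneg _)).trans h2
    rw [he, Finset.sum_add_distrib]
    linarith
  set E : ℝ → ℝ := fun r => ∑ s ∈ J with r < s, e s with hE
  have hE0 : ∀ r, 0 ≤ E r := fun r => Finset.sum_nonneg fun s _ => he0 s
  have hEle : ∀ r, E r ≤ 2 * ε := fun r =>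
    (Finset.sum_le_sum_of_subset_of_nonneg (Finset.filter_subset _ _)
      fun s _ _ => he0 s).trans hesum
  set R : ℝ → ℝ := fun r => ∑ s ∈ S with r < s, ρ s with hR
  have hR0 : ∀ r, 0 ≤ R r := fun r => Finset.sum_nonneg fun s _ => hρ s
  have hRle : ∀ r, R r ≤ ∑ s ∈ S, ρ s := fun r =>
    Finset.sum_le_sum_of_subset_of_nonneg (Finset.filter_subset _ _) fun s _ _ => hρ s
  -- when `s` is a jump of `γ_k`, `Γ s = γ s`, so the masses in one step add up to `Γ s - Γ r`
  set Γ : ℝ → ℝ := fun r => γ (timeScaleInv β γ k (timeScale β γ k r)) with hΓ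
  have hΓ0 : ∀ r, 0 ≤ Γ r := fun r => nonneg_of_zero h0 (timeScaleInv_nonneg _ _ _ _)
  have hΓT : Γ t ≤ γ T := γ.mono ((timeScaleInv_le ht0 le_rfl).trans ht)
  -- every upper bound of this shape produced in the recursion is at most `M`
  have hcap : ∀ {w A u : ℝ}, w ≤ A * Real.exp u → A ≤ b + 2 → u ≤ D * γ T → w ≤ M := by
    intro w A u h1 h2 h3
    refine h1.trans (le_trans ?_ hM)
    exact mul_le_mul h2 (Real.exp_le_exp.2 h3) (Real.exp_pos _).le (by linarith)
  have key : 1 + X r ≤ (1 + x₀ + E r) * Real.exp (D * (Γ t - Γ r)) ∧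
      Real.exp (-(2 * C * (Γ t - Γ r) + R r)) * x₀ - E r ≤ X r := by
    refine jump_induction h0 hβ (P := fun r =>
      1 + X r ≤ (1 + x₀ + E r) * Real.exp (D * (Γ t - Γ r)) ∧
      Real.exp (-(2 * C * (Γ t - Γ r) + R r)) * x₀ - E r ≤ X r) ?_ ?_ hr hrt
    · intro r hr hrt h
      have h1 : X r = x₀ := by
        simp only [hXdef, h, hn, multiPgf_self, hx₀]
      have h2 : Γ r = Γ t := by simp only [hΓ, h]
      rw [h1, h2, sub_self, mul_zero, Real.exp_zero, mul_zero, zero_add]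
      have h3 : Real.exp (-R r) ≤ 1 := Real.exp_le_one_iff.2 (by linarith [hR0 r])
      have h4 := mul_le_mul_of_nonneg_right h3 hx₀0
      constructor <;> linarith [hE0 r]
    · rintro r s hr hst hnj ⟨ih1, ih2⟩
      have hs0 : 0 < s := hr.trans_lt hnj.lt
      have hsT := hst.trans ht
      have hrec := hnj.recursion hk b₁ c m p (n := n) (hmono hst) z (X := X s) (Y := Y s)
        (X' := X r) rfl rfl rfl
      obtain ⟨hrecY, hrecX⟩ := hrec
      set a := timeScaleInv β γ k (timeScale β γ k r) with ha
      have ha0 : 0 ≤ a := timeScaleInv_nonneg _ _ _ _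
      set P := γ.measure.real (Ioo a s) with hP
      set q := γ.measure.real {s} with hq
      have hP0 : 0 ≤ P := measureReal_nonneg
      have hq0 : 0 ≤ q := measureReal_nonneg
      have hPq : P + q = γ s - Γ r := hnj.measureReal_add hr
      have hΓs : Γ s = γ s := by simp only [hΓ, hnj.timeScaleInv_eq hβ hr]
      have hΓst : Γ s ≤ Γ t := by
        rw [hΓs]
        refine γ.mono ?_
        rw [← hnj.timeScaleInv_eq hβ hr]
        refine le_csInf ⟨t, ht0, le_rfl⟩ fun u hu => timeScaleInv_le hu.1 ((hmono hst).trans hu.2)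
      have hEs : e s + E s ≤ E r :=
        add_sum_filter_lt_le he0 hnj.lt fun hnot =>
          absurd ((finite_jumpSet γ hβ 0 T).mem_toFinset.2 (hnj.mem_jumpSet hr hsT)) hnot
      have hRs : ρ s + R s ≤ R r := add_sum_filter_lt_le hρ hnj.lt (hρS s)
      have hEr := hEle r
      have hes : e s = e₁ s + e₂ s := rfl
      have hΓr := hΓ0 r
      -- upper bounds, first over the atom, then over the open interval
      have hXM : X s ≤ M := by
        have := hcap ih1 (by linarith [he0 s])
          (mul_le_mul_of_nonneg_left (by linarith [hΓ0 s]) hD0.le)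
        linarith
      have hmX : min (X s) M = X s := min_eq_left hXM
      have he₂s : |err₂ β γ b₁ c m p k s (X s)| = e₂ s := by rw [he₂]; simp only [hmX]
      have hphis := mul_le_mul_of_nonneg_right
        (hD.neg_le_phi hadm.c_nonneg hs0.le (hX0 s)) hq0
      have hY1 : 1 + Y s ≤ (1 + X s) * (1 + D * q) + e₂ s := by
        have := neg_abs_le (err₂ β γ b₁ c m p k s (X s))
        rw [hrecY]
        linarith
      have hupY := gronwall_upper_step ih1 hY1 (by linarith [hX0 s])
        (by rw [← mul_add]; exact mul_nonneg hD0.le (by linarith)) (he₂0 s)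
      have hYM : Y s ≤ M := by
        have := hcap hupY (by linarith [he₁0 s, he₂0 s])
          (by rw [← mul_add]; exact mul_le_mul_of_nonneg_left (by linarith) hD0.le)
        linarith
      have hmY : min (Y s) M = Y s := min_eq_left hYM
      have he₁s : |err₁ β γ b₁ c m p k s (Y s)| = e₁ s := by rw [he₁]; simp only [hmY]
      have hfin : γ.measure (Ioo a s) ≠ ⊤ := by simp [γ.measure_Ioo]
      have hint_lower : -(D * (1 + Y s) * P) ≤ ∫ u in Ioo a s, phi b₁ c m u (Y s) ∂γ.measure := by
        have := setIntegral_le_of_le_const (μ := γ.measure) (f := fun u => -phi b₁ c m u (Y s))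
          measurableSet_Ioo hfin (C := D * (1 + Y s))
          (mul_nonneg hD0.le (by linarith [hY0 s])) fun u hu => by
            have := hD.neg_le_phi hadm.c_nonneg (ha0.trans hu.1.le) (hY0 s)
            linarith
        rw [integral_neg] at this
        linarith
      have hint_upper : ∫ u in Ioo a s, phi b₁ c m u (Y s) ∂γ.measure ≤ C * Y s * P :=
        setIntegral_le_of_le_const measurableSet_Ioo hfin (mul_nonneg hC0.le (hY0 s))
          fun u hu => hD.phi_le (ha0.trans hu.1.le) (hY0 s) hYM
      have hX1 : 1 + X r ≤ (1 + Y s) * (1 + D * P) + e₁ s := by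
        have := neg_abs_le (err₁ β γ b₁ c m p k s (Y s))
        rw [hrecX]
        linarith
      have hupX := gronwall_upper_step hupY hX1 (by linarith [hY0 s])
        (by rw [← mul_add, ← mul_add]; exact mul_nonneg hD0.le (by linarith)) (he₁0 s)
      have hexp : D * (Γ t - Γ s) + D * q + D * P = D * (Γ t - Γ r) := by
        rw [hΓs, ← mul_add, ← mul_add]
        congr 1
        linarith
      rw [hexp] at hupX
      refine ⟨hupX.trans (mul_le_mul_of_nonneg_right (by linarith) (Real.exp_pos _).le), ?_⟩
      -- lower bounds, in the same order
      have hY2 : Real.exp (-(2 * C * q + ρ s)) * X s - e₂ s ≤ Y s := by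
        have h1 := hatom s hs0 hsT (X s) (hX0 s) hXM
        have h2 := le_abs_self (err₂ β γ b₁ c m p k s (X s))
        linarith
      have hX2 : Real.exp (-(2 * (C * P))) * Y s - e₁ s ≤ X r := by
        have hCP : C * P ≤ 1 / 4 := by
          have h1 : β k * P ≤ 1 := hnj.mul_measureReal_Ioo_le_one h0 hβ hr
          have h2 := mul_le_mul_of_nonneg_right hβC hP0
          linarith
        have h1 := mul_le_mul_of_nonneg_right
          (exp_neg_two_mul_le (mul_nonneg hC0.le hP0) hCP) (hY0 s)
        have h2 := le_abs_self (err₁ β γ b₁ c m p k s (Y s))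
        linarith
      have hloY := gronwall_lower_step ih2 hY2 (add_nonneg (by positivity) (hρ s)) (hE0 s)
      have hloX := gronwall_lower_step hloY hX2 (by positivity) (add_nonneg (hE0 s) (he₂0 s))
      refine le_trans ?_ hloX
      have h1 : Real.exp (-(2 * C * (Γ t - Γ r) + R r)) ≤
          Real.exp (-(2 * C * (Γ t - Γ s) + R s + (2 * C * q + ρ s) + 2 * (C * P))) := by
        refine Real.exp_le_exp.2 ?_
        have : 2 * C * (Γ t - Γ s) + 2 * C * q + 2 * (C * P) = 2 * C * (Γ t - Γ r) := by
          linear_combination (-2 * C) * hΓs + 2 * C * hPq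
        linarith
      have h2 := mul_le_mul_of_nonneg_right h1 hx₀0
      linarith
  constructor
  · have := hcap key.1 (by linarith [hEle r])
      (mul_le_mul_of_nonneg_left (by linarith [hΓ0 r]) hD0.le)
    linarith
  · refine le_trans ?_ key.2
    have h1 : Real.exp (-(2 * C * γ T + ∑ s ∈ S, ρ s)) ≤
        Real.exp (-(2 * C * (Γ t - Γ r) + R r)) := by
      refine Real.exp_le_exp.2 ?_
      have : 2 * C * (Γ t - Γ r) ≤ 2 * C * γ T :=
        mul_le_mul_of_nonneg_left (by linarith [hΓ0 r]) (by positivity)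
      linarith [hRle r]
    have h2 := mul_le_mul_of_nonneg_right h1 hx₀0
    linarith [hEle r]

/-! ### Uniform bounds on the cumulant semigroup -/

/-- Condition (A), applied on `(0, T]` to the same function of `s` for every `k`. -/
theorem ConditionA.exists_error_bound {γ : StieltjesFunction ℝ} {b₁ c : ℝ → ℝ} {m : Kernel ℝ ℝ}
    {β : ℕ → ℝ} {p : ℕ → ℕ → PMF ℕ} (hA : ConditionA β γ b₁ c m p) {M T : ℝ} (hM : 0 < M)
    (hT : 0 ≤ T) : ∃ G : ℕ → ℝ, Tendsto G atTop (𝓝 0) ∧ ∀ k : ℕ, 1 ≤ k → M ≤ k →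
      ∀ hβ : 0 < β k, ∀ f : ℝ → ℝ, (∀ s, f s ∈ Icc 0 M) →
        ∑ s ∈ (finite_jumpSet γ hβ 0 T).toFinset, err β γ b₁ c m p k s (f s) ≤ G k := by
  obtain ⟨F, hF, hlim, hsum⟩ := hA M hM
  refine ⟨fun k => F k T, hlim T hT, fun k hk hMk hβ f hf => ?_⟩
  have h := hsum T hT (fun _ => f) (fun _ _ s _ => hf s) k hk hMk 0 T le_rfl hT le_rfl
  rw [finsum_mem_eq_finite_toFinset_sum _ (finite_jumpSet γ hβ 0 T)] at h
  linarith [(hF k hk).1 0 le_rfl]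

/-- Passing from `k (1 - y)` to `-k log y`. -/
theorem le_neg_mul_log_and_le {k y M : ℝ} (hk : 0 < k) (hM : 2 * M ≤ k)
    (hy : k * (1 - y) ≤ M) :
    k * (1 - y) ≤ -k * Real.log y ∧ (0 ≤ 1 - y → -k * Real.log y ≤ 2 * M) := by
  have hy2 : 1 / 2 ≤ y := by
    by_contra h
    have := mul_lt_mul_of_pos_left (not_le.1 h) hk
    linarith
  have hy0 : 0 < y := by linarith
  constructor
  · have := mul_le_mul_of_nonneg_left (Real.log_le_sub_one_of_pos hy0) hk.le
    linarith
  · intro h1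
    have h2 : -Real.log y ≤ 2 * (1 - y) := by
      have h3 := Real.one_sub_inv_le_log_of_pos hy0
      have h4 : y⁻¹ - 1 = (1 - y) * y⁻¹ := by field_simp
      have h5 : y⁻¹ ≤ 2 := by
        rw [inv_le_comm₀ hy0 two_pos]
        linarith
      nlinarith [mul_le_mul_of_nonneg_left h5 h1]
    have := mul_le_mul_of_nonneg_left h2 hk.le
    linarith

end GWVE

theorem mainTheorem3
    (γ : StieltjesFunction ℝ) (b₁ c : ℝ → ℝ) (m : Kernel ℝ ℝ)
    (hadm : GWVE.Admissible γ b₁ c m)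
    (β : ℕ → ℝ) (hβ_mono : ∀ j k : ℕ, 1 ≤ j → j ≤ k → β j ≤ β k)
    (hβ_lim : Tendsto β atTop atTop)
    (p : ℕ → ℕ → PMF ℕ)
    (hA : GWVE.ConditionA β γ b₁ c m p)
    (T a b : ℝ) (hT : 0 ≤ T) (ha : 0 < a) (hab : a < b) :
    ∃ N₁ : ℕ, 1 ≤ N₁ ∧ ∃ l U : ℝ, 0 < l ∧ l ≤ U ∧
      ∀ k : ℕ, N₁ ≤ k → ∀ r t : ℝ, 0 ≤ r → r ≤ t → t ≤ T → ∀ lam : ℝ, a ≤ lam → lam ≤ b →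
        l ≤ GWVE.cumulant β γ p k r t lam ∧ GWVE.cumulant β γ p k r t lam ≤ U := by
  obtain ⟨D, hD0, hD⟩ := hadm.exists_coeffBound
  have hb : 0 < b := ha.trans hab
  set M := (b + 2) * Real.exp (D * γ T) with hM
  have hM0 : 0 < M := by positivity
  have hγT : 0 ≤ γ T := GWVE.nonneg_of_zero hadm.γ_zero hT
  have hbM : b ≤ M := by
    have := Real.one_le_exp (mul_nonneg hD0.le hγT)
    nlinarith
  obtain ⟨S, ρ, hρ, hρS, hatom⟩ := hadm.exists_atom_lower_bound hD0 hD hM0 T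
  obtain ⟨G, hG, herr⟩ := hA.exists_error_bound hM0 hT
  set Q := Real.exp (-(2 * (D * (1 + 2 * M)) * γ T + ∑ s ∈ S, ρ s)) with hQ
  have hQ0 : 0 < Q := Real.exp_pos _
  have hQ1 : Q ≤ 1 := by
    refine Real.exp_le_one_iff.2 (neg_nonpos.2 (add_nonneg (by positivity) ?_))
    exact Finset.sum_nonneg fun s _ => hρ s
  -- `ε` is chosen so that the errors use up at most half of the lower bound `Q a / 2`
  set ε := min (1 / 2) (Q * a / 8) with hε
  have hε0 : 0 < ε := by positivity
  have hev : ∀ᶠ k : ℕ in atTop, 1 ≤ k ∧ 2 * M ≤ (k : ℝ) ∧ 4 * (D * (1 + 2 * M)) ≤ β k ∧ G k < ε :=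
    (eventually_ge_atTop 1).and ((tendsto_natCast_atTop_atTop.eventually_ge_atTop _).and
      ((hβ_lim.eventually_ge_atTop _).and (hG.eventually_lt_const hε0)))
  obtain ⟨N, hN⟩ := eventually_atTop.1 hev
  refine ⟨max N 1, le_max_right _ _, Q * a / 4, 2 * M, by positivity, by nlinarith,
    fun k hk r t hr hrt ht lam hal hlb => ?_⟩
  obtain ⟨hk1, hkM, hβC, hGk⟩ := hN k ((le_max_left _ _).trans hk)
  have hk0 : (0 : ℝ) < k := by exact_mod_cast hk1
  have hβ : 0 < β k := lt_of_lt_of_le (by positivity) hβC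
  have hlam : 0 < lam := ha.trans_le hal
  have hu0 : 0 ≤ lam / k := by positivity
  have hu1 : lam / k ≤ 1 / 2 := by
    rw [div_le_iff₀ hk0]
    linarith
  have hneg : -lam / k = -(lam / k) := neg_div _ _
  have hz : Real.exp (-lam / k) ∈ Icc (0 : ℝ) 1 :=
    ⟨(Real.exp_pos _).le, Real.exp_le_one_iff.2 (by rw [hneg]; linarith)⟩
  have hlk : (k : ℝ) * (lam / k) = lam := by field_simp
  have hz1 : k * (1 - Real.exp (-lam / k)) ≤ lam := by
    have h1 := Real.add_one_le_exp (-lam / k)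
    have h2 : 1 - Real.exp (-lam / k) ≤ lam / k := by rw [hneg] at h1 ⊢; linarith
    have := mul_le_mul_of_nonneg_left h2 hk0.le
    linarith
  have hz2 : lam / 2 ≤ k * (1 - Real.exp (-lam / k)) := by
    have h1 := GWVE.exp_neg_le hu0
    rw [← hneg] at h1
    have h2 : lam / k / 2 ≤ 1 - Real.exp (-lam / k) := by nlinarith
    have := mul_le_mul_of_nonneg_left h2 hk0.le
    linarith
  obtain ⟨hup, hlo⟩ := GWVE.scaled_pgf_bounds hadm hD0 hD hM.ge hb hρ hρS hatom hk1 hβ hβC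
    (ε := ε) (by linarith [min_le_left (1 / 2) (Q * a / 8)])
    (fun f hf => (herr k hk1 (by linarith) hβ f hf).trans hGk.le) hz (hz1.trans hlb) hr hrt ht
  obtain ⟨h1, h2⟩ := GWVE.le_neg_mul_log_and_le hk0 hkM hup
  refine ⟨le_trans ?_ h1, h2 (sub_nonneg.2 (GWVE.multiPgf_mem_Icc _ _ _ hz).2)⟩
  refine le_trans ?_ hlo
  have h3 := mul_le_mul_of_nonneg_left hz2 hQ0.le
  have h4 := mul_le_mul_of_nonneg_left hal hQ0.le
  have h5 : ε ≤ Q * a / 8 := min_le_right _ _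
  rw [← hQ]
  linarith
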